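/- Let $\mathcal{A}$ be a semi-abelian category (pointed, Barr exact, Bourn protomodular, with binary coproducts) with enough regular projectives. A \emph{Birkhoff subcategory} is a full reflective subcategory closed under subobjects and regular quotients. Let $\mathcal{B}$ be a Birkhoff subcategory of $\mathcal{A}$ with reflector $I$, and $\mathcal{C}$ a Birkhoff subcategory of $\mathcal{B}$ with reflector $J$, so that $JI\colon \mathcal{A}\to\mathcal{C}$ is the reflector of $\mathcal{C}$ in $\mathcal{A}$. For a reflector $R\colon\mathcal{X}\to\mathcal{D}$ onto a full reflective subcategory $\mathcal{D}$, with unit $\eta$, write $[X,X]_{\mathcal{D}}$ for the kernel of $\eta_X\colon X\to R(X)$ (a functor of $X$). An \emph{extension} is a regular epimorphism $f\colon Y\to X$. It is \emph{$R$-trivial} if the naturality square of $\eta$ at $f$ is a pullback, and \emph{$R$-central} if its pullback along some extension of $X$ is $R$-trivial. A \emph{universal $R$-central extension} of $X$ is an initial object among the $R$-central extensions of $X$. The object $X$ is \emph{$R$-perfect} if $R(X)=0$. For an extension $f\colon P\to X$ with kernel $K$ and kernel pair $f_0,f_1\colon P\times_XP\to P$, let $[K,P]_{\mathcal{D}}$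 be the kernel of $[f_0,f_0]_{\mathcal{D}}$, mapped to $[P,P]_{\mathcal{D}}$ by $[f_1,f_1]_{\mathcal{D}}$. When $P$ is regular projective in $\mathcal{X}$, put \[ \mathrm{U}(X,R)=\frac{[P,P]_{\mathcal{D}}}{[K,P]_{\mathcal{D}}},\qquad \mathrm{H}_2(X,R)=\frac{K\wedge[P,P]_{\mathcal{D}}}{[K,P]_{\mathcal{D}}}, \] and let $u_X^{R}\colon \mathrm{U}(X,R)\to X$ be the morphism induced by $f$. Let $B$ be a $J$-perfect object of $\mathcal{B}$. For every choice of a projective presentation of $B$ in $\mathcal{A}$, used to define $\mathrm{U}(B,JI)$, $\mathrm{H}_2(B,JI)$ and $u_B^{JI}$, and of a projective presentation of $B$ in $\mathcal{B}$, used to define $\mathrm{U}(B,J)$, $\mathrm{H}_2(B,J)$ and $u_B^{J}$, the following hold. (1) $u_B^{JI}$ is a universal $JI$-central extension of $B$ in $\mathcal{A}$, and $u_B^{J}$ is a universal $J$-central extension of $B$ in $\mathcal{B}$. (2) There is a morphism $c\colon\mathrm{U}(B,JI)\to\mathrm{U}(B,J)$ over $B$, and a short exact sequence in $\mathcal{A}$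 \[ 0\to[\mathrm{U}(B,JI),\mathrm{U}(B,JI)]_{\mathcal{B}}\to\mathrm{H}_2(B,JI)\to\mathrm{H}_2(B,J)\to0 \] in which the first morphism is compatible with the canonical morphisms from $[\mathrm{U}(B,JI),\mathrm{U}(B,JI)]_{\mathcal{B}}$ and $\mathrm{H}_2(B,JI)$ to $\mathrm{U}(B,JI)$, and the second one is compatible with $c$ and the canonical morphisms $\mathrm{H}_2(B,JI)\to\mathrm{U}(B,JI)$ and $\mathrm{H}_2(B,J)\to\mathrm{U}(B,J)$. (3) The extensions $u_B^{JI}$ and $u_B^{J}$ coincide, that is, there is an isomorphism $\mathrm{U}(B,JI)\cong\mathrm{U}(B,J)$ over $B$, if and only if $[\mathrm{U}(B,JI),\mathrm{U}(B,JI)]_{\mathcal{B}}=0$. -/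

import Mathlib

open CategoryTheory CategoryTheory.Limits

universe v u

noncomputable section

namespace SemiAb

section Categories

/-- A semi-abelian category: pointed, Barr exact (regular, and every internal equivalence relation
is a kernel pair), Bourn protomodular (in the form of the Regular Short Five Lemma), with binary
coproducts. -/
class SemiAbelian (𝒳 : Type u) [Category.{v} 𝒳] [HasZeroMorphisms 𝒳] : Prop extends
    Regular 𝒳, HasZeroObject 𝒳, HasBinaryCoproducts 𝒳 where
  exact {R X : 𝒳} (p₁ p₂ : R ⟶ X) : IsEquivalenceRelation p₁ p₂ →
    ∃ (Y : 𝒳) (q : X ⟶ Y), IsKernelPair q p₁ p₂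
  shortFive {B' A' B A : 𝒳} (f' : B' ⟶ A') (f : B ⟶ A) (k : kernel f' ⟶ kernel f)
    (b : B' ⟶ B) (a : A' ⟶ A) : IsRegularEpi f' → IsRegularEpi f →
    kernel.ι f' ≫ b = k ≫ kernel.ι f → f' ≫ a = b ≫ f → IsIso k → IsIso a → IsIso b

/-- (Regular) projectivity: the lifting property with respect to regular epimorphisms. -/
def IsRegProjective {𝒳 : Type u} [Category.{v} 𝒳] (P : 𝒳) : Prop :=
  ∀ ⦃X Y : 𝒳⦄ (e : X ⟶ Y) (g : P ⟶ Y), IsRegularEpi e → ∃ h : P ⟶ X, h ≫ e = g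

/-- `p : P ⟶ A` is a projective presentation of `A`. -/
structure IsProjPresentation {𝒳 : Type u} [Category.{v} 𝒳] {P A : 𝒳} (p : P ⟶ A) : Prop where
  regularEpi : IsRegularEpi p
  projective : IsRegProjective P

/-- Every object has a projective presentation. -/
class EnoughRegProjectives (𝒳 : Type u) [Category.{v} 𝒳] : Prop where
  exists_presentation (A : 𝒳) : ∃ (P : 𝒳) (p : P ⟶ A), IsProjPresentation p

/-- A Birkhoff subcategory: a full reflective subcategory closed under subobjects and under
regular quotients. -/
class Birkhoff {𝒳 : Type u} [Category.{v} 𝒳] (ℬ : ObjectProperty 𝒳) extends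
    Reflective ℬ.ι where
  subobject {X Y : 𝒳} (m : X ⟶ Y) : Mono m → ℬ Y → ℬ X
  quotient {X Y : 𝒳} (e : X ⟶ Y) : IsRegularEpi e → ℬ X → ℬ Y

/-- The sequence `0 ⟶ X ⟶ Y ⟶ Z ⟶ 0` is short exact: `k` is the kernel of `q` and `q` is the
cokernel of `k`. -/
def IsShortExact {𝒳 : Type u} [Category.{v} 𝒳] [HasZeroMorphisms 𝒳] {X Y Z : 𝒳}
    (k : X ⟶ Y) (q : Y ⟶ Z) : Prop :=
  ∃ w : k ≫ q = 0, Nonempty (IsLimit (KernelFork.ofι k w)) ∧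
    Nonempty (IsColimit (CokernelCofork.ofπ q w))

end Categories

section Coequalizers

/-! Existence of the limits and colimits used below. -/

variable {𝒳 : Type u} [Category.{v} 𝒳] [HasZeroMorphisms 𝒳] [SemiAbelian 𝒳]

/-- A reflexive relation in a semi-abelian category is Euclidean. -/
theorem exists_euclid {R Y : 𝒳} (p₁ p₂ : R ⟶ Y)
    (hm : ∀ ⦃T : 𝒳⦄ (a b : T ⟶ R), a ≫ p₁ = b ≫ p₁ → a ≫ p₂ = b ≫ p₂ → a = b)
    (r : Y ⟶ R) (h₁ : r ≫ p₁ = 𝟙 Y) (h₂ : r ≫ p₂ = 𝟙 Y) :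
    ∃ τ : pullback p₁ p₁ ⟶ R, τ ≫ p₁ = pullback.fst p₁ p₁ ≫ p₂ ∧
      τ ≫ p₂ = pullback.snd p₁ p₁ ≫ p₂ := by
  have : Mono (prod.lift p₁ p₂) := ⟨fun a b h => hm a b
    (by simpa [prod.lift_fst] using congrArg (· ≫ prod.fst) h)
    (by simpa [prod.lift_snd] using congrArg (· ≫ prod.snd) h)⟩
  let d : pullback p₁ p₁ ⟶ Y ⨯ Y :=
    prod.lift (pullback.fst p₁ p₁ ≫ p₂) (pullback.snd p₁ p₁ ≫ p₂)
  let t : pullback d (prod.lift p₁ p₂) ⟶ pullback p₁ p₁ := pullback.fst _ _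
  let w : pullback d (prod.lift p₁ p₂) ⟶ R := pullback.snd _ _
  have hw₁ : w ≫ p₁ = t ≫ pullback.fst p₁ p₁ ≫ p₂ := by
    have := congrArg (· ≫ prod.fst) (pullback.condition (f := d) (g := prod.lift p₁ p₂))
    simpa [d, prod.lift_fst] using this.symm
  have hw₂ : w ≫ p₂ = t ≫ pullback.snd p₁ p₁ ≫ p₂ := by
    have := congrArg (· ≫ prod.snd) (pullback.condition (f := d) (g := prod.lift p₁ p₂))
    simpa [d, prod.lift_snd] using this.symm
  suffices IsIso t from ⟨inv t ≫ w, by simp [hw₁], by simp [hw₂]⟩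
  let f : pullback p₁ p₁ ⟶ R := pullback.fst p₁ p₁
  have hf : IsRegularEpi f := by
    have : IsSplitEpi f := ⟨⟨pullback.lift (𝟙 R) (𝟙 R) rfl, pullback.lift_fst _ _ _⟩⟩
    infer_instance
  have hf' : IsRegularEpi (t ≫ f) := by
    have : IsSplitEpi (t ≫ f) := ⟨⟨pullback.lift (pullback.lift (𝟙 R) (𝟙 R) rfl) (p₂ ≫ r)
      (by ext <;> simp [d, h₁, h₂, prod.lift_fst, prod.lift_snd, pullback.lift_fst_assoc,
        pullback.lift_snd_assoc]),
        by simp only [t, f, pullback.lift_fst_assoc, pullback.lift_fst]⟩⟩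
    infer_instance
  let k : kernel (t ≫ f) ⟶ kernel f := kernel.lift f (kernel.ι (t ≫ f) ≫ t) (by simp)
  have hx : kernel.ι f ≫ pullback.snd p₁ p₁ ≫ p₁ = 0 := by
    rw [← pullback.condition, ← Category.assoc]
    simp [f]
  let l : kernel f ⟶ pullback d (prod.lift p₁ p₂) :=
    pullback.lift (kernel.ι f) (kernel.ι f ≫ pullback.snd p₁ p₁) (by
      ext
      · have : kernel.ι f ≫ pullback.fst p₁ p₁ = 0 := kernel.condition f
        simp [d, hx, prod.lift_fst, reassoc_of% this]
      · simp [d, prod.lift_snd])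
  have hlt : l ≫ t = kernel.ι f := pullback.lift_fst _ _ _
  have hk : IsIso k := by
    refine ⟨kernel.lift (t ≫ f) l (by rw [← Category.assoc, hlt, kernel.condition]), ?_, ?_⟩
    · rw [← cancel_mono (kernel.ι (t ≫ f)), ← cancel_mono t]
      simp [k, hlt]
    · rw [← cancel_mono (kernel.ι f)]
      simp [k, hlt]
  exact SemiAbelian.shortFive (t ≫ f) f k t (𝟙 R) hf' hf (by simp [k]) (by simp) hk inferInstance

theorem isEquivalenceRelation_of_refl {R Y : 𝒳} (p₁ p₂ : R ⟶ Y)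
    (hm : ∀ ⦃T : 𝒳⦄ (a b : T ⟶ R), a ≫ p₁ = b ≫ p₁ → a ≫ p₂ = b ≫ p₂ → a = b)
    (r : Y ⟶ R) (h₁ : r ≫ p₁ = 𝟙 Y) (h₂ : r ≫ p₂ = 𝟙 Y) : IsEquivalenceRelation p₁ p₂ := by
  obtain ⟨τ, hτ₁, hτ₂⟩ := exists_euclid p₁ p₂ hm r h₁ h₂
  let s : R ⟶ R := pullback.lift (𝟙 R) (p₁ ≫ r) (by simp [h₁]) ≫ τ
  have hs₁ : s ≫ p₁ = p₂ := by simp [s, hτ₁, pullback.lift_fst_assoc]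
  have hs₂ : s ≫ p₂ = p₁ := by simp [s, hτ₂, h₂, pullback.lift_snd_assoc]
  exact ⟨⟨{
    right_cancellation := hm
    r := r
    reflexivity₁ := h₁
    reflexivity₂ := h₂
    s := s
    symmetry₁ := hs₁
    symmetry₂ := hs₂
    c := pullback.cone p₂ p₁
    isLimit := pullback.isLimit p₂ p₁
    t := pullback.lift (pullback.fst p₂ p₁ ≫ s) (pullback.snd p₂ p₁)
      (by simp [hs₁, pullback.condition]) ≫ τ
    transitivity₁ := by simp [hτ₁, hs₂, pullback.lift_fst_assoc]
    transitivity₂ := by simp [hτ₂, pullback.lift_snd_assoc] }⟩⟩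

instance hasCoequalizers : HasCoequalizers 𝒳 := by
  suffices h : ∀ {X Y : 𝒳} {f g : X ⟶ Y}, HasColimit (parallelPair f g) from
    hasCoequalizers_of_hasColimit_parallelPair 𝒳
  intro X Y f g
  let F := Regular.strongEpiMonoFactorisation
    (coprod.desc (prod.lift f g) (prod.lift (𝟙 Y) (𝟙 Y)))
  have hF : F.e ≫ F.m = coprod.desc (prod.lift f g) (prod.lift (𝟙 Y) (𝟙 Y)) := F.fac
  obtain ⟨p₁, hp₁⟩ : ∃ p₁ : F.I ⟶ Y, p₁ = F.m ≫ prod.fst := ⟨_, rfl⟩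
  obtain ⟨p₂, hp₂⟩ : ∃ p₂ : F.I ⟶ Y, p₂ = F.m ≫ prod.snd := ⟨_, rfl⟩
  have hf : (coprod.inl ≫ F.e) ≫ p₁ = f := by
    rw [hp₁, Category.assoc, reassoc_of% hF, coprod.inl_desc_assoc, prod.lift_fst]
  have hg : (coprod.inl ≫ F.e) ≫ p₂ = g := by
    rw [hp₂, Category.assoc, reassoc_of% hF, coprod.inl_desc_assoc, prod.lift_snd]
  have hr₁ : (coprod.inr ≫ F.e) ≫ p₁ = 𝟙 Y := by
    rw [hp₁, Category.assoc, reassoc_of% hF, coprod.inr_desc_assoc, prod.lift_fst]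
  have hr₂ : (coprod.inr ≫ F.e) ≫ p₂ = 𝟙 Y := by
    rw [hp₂, Category.assoc, reassoc_of% hF, coprod.inr_desc_assoc, prod.lift_snd]
  have hEq : IsEquivalenceRelation p₁ p₂ := by
    refine isEquivalenceRelation_of_refl p₁ p₂ (fun T a b h h' => ?_) (coprod.inr ≫ F.e) hr₁ hr₂
    rw [← cancel_mono F.m]
    ext
    · simpa [hp₁] using h
    · simpa [hp₂] using h'
  obtain ⟨Z, q, hq⟩ := SemiAbelian.exact p₁ p₂ hEq
  have : HasCoequalizer p₁ p₂ := Regular.hasCoequalizer_of_isKernelPair hq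
  have hc : f ≫ coequalizer.π p₁ p₂ = g ≫ coequalizer.π p₁ p₂ := by
    have h := congrArg ((coprod.inl ≫ F.e) ≫ ·) (coequalizer.condition p₁ p₂)
    simp only [← Category.assoc] at h hf hg
    rwa [hf, hg] at h
  refine ⟨⟨⟨Cofork.ofπ (coequalizer.π p₁ p₂) hc, Cofork.IsColimit.mk' _ fun s => ?_⟩⟩⟩
  have hs : p₁ ≫ s.π = p₂ ≫ s.π := by
    rw [← cancel_epi F.e]
    apply coprod.hom_ext
    · simpa [← hf, ← hg] using (show f ≫ s.π = g ≫ s.π from s.condition)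
    · have h : ((coprod.inr ≫ F.e) ≫ p₁) ≫ s.π = ((coprod.inr ≫ F.e) ≫ p₂) ≫ s.π := by
        rw [hr₁, hr₂]
      simpa using h
  refine ⟨coequalizer.desc s.π hs, coequalizer.π_desc _ _, fun {m} hm => ?_⟩
  exact coequalizer.hom_ext (hm.trans (coequalizer.π_desc s.π hs).symm)

end Coequalizers

section Subcategories

variable {𝒳 : Type u} [Category.{v} 𝒳] (ℬ : ObjectProperty 𝒳) [Reflective ℬ.ι]

instance hasFiniteLimits_fullSubcategory [HasFiniteLimits 𝒳] :
    HasFiniteLimits ℬ.FullSubcategory :=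
  ⟨fun _ _ _ => hasLimitsOfShape_of_reflective ℬ.ι⟩

instance hasCoequalizers_fullSubcategory [HasCoequalizers 𝒳] :
    HasCoequalizers ℬ.FullSubcategory :=
  hasColimitsOfShape_of_reflective ℬ.ι

end Subcategories

section Central

/-! In this section and the next, the inclusion of the subcategory is a reflective functor
`i : 𝒟 ⥤ 𝒳`, with reflector `reflector i`. -/

variable {𝒳 : Type*} {𝒟 : Type*} [Category 𝒳] [Category 𝒟] (i : 𝒟 ⥤ 𝒳) [Reflective i]

/-- The unit `X ⟶ I X` of the reflection. -/
def unitMap (X : 𝒳) : X ⟶ i.obj ((reflector i).obj X) := (reflectorAdjunction i).unit.app X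

/-- An object is perfect when its reflection is zero. -/
def IsPerfect (X : 𝒳) : Prop := IsZero ((reflector i).obj X)

/-- Trivial extensions: regular epimorphisms whose naturality square for the unit is a pullback. -/
def IsTrivialExt {B A : 𝒳} (f : B ⟶ A) : Prop :=
  IsRegularEpi f ∧ IsPullback f (unitMap i B) (unitMap i A) (i.map ((reflector i).map f))

/-- Central extensions: extensions whose pullback along some extension is trivial. -/
def IsCentralExt [HasPullbacks 𝒳] {B A : 𝒳} (f : B ⟶ A) : Prop :=
  IsRegularEpi f ∧ ∃ (C : 𝒳) (g : C ⟶ A), IsRegularEpi g ∧ IsTrivialExt i (pullback.snd f g)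

/-- Universal central extensions of `A`: initial among the central extensions of `A`. -/
def IsUniversalCentralExt [HasPullbacks 𝒳] {U A : 𝒳} (u : U ⟶ A) : Prop :=
  IsCentralExt i u ∧
    ∀ (B : 𝒳) (f : B ⟶ A), IsCentralExt i f → ∃! h : U ⟶ B, h ≫ f = u

end Central

section Baer

variable {𝒳 : Type*} {𝒟 : Type*} [Category 𝒳] [Category 𝒟] (i : 𝒟 ⥤ 𝒳) [Reflective i]
  [HasZeroMorphisms 𝒳] [HasFiniteLimits 𝒳]

/-- The zero-dimensional commutator `[X, X]`, the kernel of the unit of the reflection. -/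
abbrev zeroComm (X : 𝒳) : 𝒳 := kernel (unitMap i X)

/-- The inclusion `μ : [X, X] ⟶ X`. -/
def zeroCommι (X : 𝒳) : zeroComm i X ⟶ X := kernel.ι (unitMap i X)

/-- The morphism `[f, f] : [X, X] ⟶ [Y, Y]`. -/
def zeroCommMap {X Y : 𝒳} (f : X ⟶ Y) : zeroComm i X ⟶ zeroComm i Y :=
  kernel.map (unitMap i X) (unitMap i Y) f (i.map ((reflector i).map f))
    ((reflectorAdjunction i).unit.naturality f).symm

theorem zeroCommMap_zeroCommι {X Y : 𝒳} (f : X ⟶ Y) :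
    zeroCommMap i f ≫ zeroCommι i Y = zeroCommι i X ≫ f := by
  simp [zeroCommMap, zeroCommι]

variable {B A : 𝒳} (f : B ⟶ A)

/-- The one-dimensional commutator `[K, B]`, where `K` is the kernel of `f : B ⟶ A`: the kernel of
`[f₀, f₀]` for the kernel pair `f₀, f₁` of `f`. -/
abbrev relComm : 𝒳 := kernel (zeroCommMap i (pullback.fst f f))

/-- The inclusion `[K, B] ⟶ [B, B]`, induced by `[f₁, f₁]`. -/
def relCommι : relComm i f ⟶ zeroComm i B :=
  kernel.ι (zeroCommMap i (pullback.fst f f)) ≫ zeroCommMap i (pullback.snd f f)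

theorem relCommι_comp : relCommι i f ≫ zeroCommι i B ≫ f = 0 := by
  have h : zeroCommMap i (pullback.snd f f) ≫ zeroCommι i B ≫ f =
      zeroCommMap i (pullback.fst f f) ≫ zeroCommι i B ≫ f := by
    rw [← Category.assoc, ← Category.assoc, zeroCommMap_zeroCommι, zeroCommMap_zeroCommι, Category.assoc,
      Category.assoc, pullback.condition]
  simp [relCommι, h]

/-- The intersection `K ∧ [B, B]` of subobjects of `B`, where `K` is the kernel of `f`. -/
abbrev kerInf : 𝒳 := pullback (kernel.ι f) (zeroCommι i B)

/-- The inclusion `[K, B] ⟶ K ∧ [B, B]`. -/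
def relCommToKerInf : relComm i f ⟶ kerInf i f :=
  pullback.lift (kernel.lift f (relCommι i f ≫ zeroCommι i B) (by simp [relCommι_comp]))
    (relCommι i f) (by simp)

/-- The inclusion `K ∧ [B, B] ⟶ [B, B]`. -/
def kerInfι : kerInf i f ⟶ zeroComm i B := pullback.snd (kernel.ι f) (zeroCommι i B)

theorem relCommToKerInf_kerInfι : relCommToKerInf i f ≫ kerInfι i f = relCommι i f := 
  pullback.lift_snd _ _ _

variable [HasCoequalizers 𝒳]

/-- The object `U(A, I) = [B, B] / [K, B]`, computed from `f : B ⟶ A` with kernel `K`. -/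
abbrev baerU : 𝒳 := cokernel (relCommι i f)

/-- The morphism `U(A, I) ⟶ A` induced by `f`. -/
def baerUMap : baerU i f ⟶ A :=
  cokernel.desc (relCommι i f) (zeroCommι i B ≫ f) (relCommι_comp i f)

/-- The Hopf formula `H₂(A, I) = (K ∧ [B, B]) / [K, B]`, computed from `f : B ⟶ A` with
kernel `K`. -/
abbrev hopfH2 : 𝒳 := cokernel (relCommToKerInf i f)

/-- The morphism `H₂(A, I) ⟶ U(A, I)` induced by the inclusion `K ∧ [B, B] ⟶ [B, B]`. -/
def hopfH2ι : hopfH2 i f ⟶ baerU i f :=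
  cokernel.map (relCommToKerInf i f) (relCommι i f) (𝟙 _) (kerInfι i f)
    (by simp [relCommToKerInf_kerInfι])

end Baer

end SemiAb

end

open SemiAb

namespace SemiAb

/-! Everything rests on `[-, -]` for a reflector with Birkhoff image: it preserves regular
epimorphisms (`isRegularEpi_zeroCommMap`), whence an extension with kernel pair `f₀, f₁` is central
iff `[f₀, f₀] = [f₁, f₁]` (`zeroCommMap_eq`, `isCentralExt`). Dividing `[P, P]` by `[K, P]` forces
this equality. A lift of `p` along a central extension, given by projectivity, factors through the
quotient, uniquely because `U` is perfect; so `U ⟶ A` is universal central. For objects of `ℬ` the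
commutators of `J` and `JI` are the same subobject, so `J`-centrality in `ℬ` is `JI`-centrality in
`𝒜`. By the two universal properties, the reflection of `U(B, JI)` in `ℬ` is `U(B, J)`. Hence `c` is
a regular epimorphism over `B` with kernel `[U, U]_ℬ`; restricting it to the kernels over `B`, which
are the objects `H₂`, gives the exact sequence, and `c` is invertible iff its kernel vanishes.
Arguments use generalized elements, lifted along covers (regular epimorphisms). -/

theorem exists_lift_of_cover {𝒳 : Type*} [Category 𝒳] {T Y M X : 𝒳} {c : T ⟶ Y}
    (hc : IsRegularEpi c) {m : M ⟶ X} (hm : Mono m) {s : T ⟶ M} {y : Y ⟶ X}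
    (h : s ≫ m = c ≫ y) : ∃ l : Y ⟶ M, l ≫ m = y :=
  have sq : CommSq s c m y := ⟨h⟩
  ⟨sq.lift, sq.fac_right⟩

theorem isIso_of_isRegularEpi_of_mono {𝒳 : Type*} [Category 𝒳] {X Y : 𝒳} {f : X ⟶ Y}
    (hf : IsRegularEpi f) (hm : Mono f) : IsIso f :=
  isIso_of_mono_of_strongEpi f

/-! ### Generalized elements and images in regular categories. -/

section Regular

variable {𝒳 : Type u} [Category.{v} 𝒳] [Regular 𝒳]

theorem isRegularEpi_comp {X Y Z : 𝒳} {f : X ⟶ Y} {g : Y ⟶ Z} (hf : IsRegularEpi f)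
    (hg : IsRegularEpi g) : IsRegularEpi (f ≫ g) := by
  have : StrongEpi (f ≫ g) := inferInstance
  infer_instance

theorem isRegularEpi_of_comp {X Y Z : 𝒳} {f : X ⟶ Y} {g : Y ⟶ Z} (h : IsRegularEpi (f ≫ g)) :
    IsRegularEpi g := by
  have : StrongEpi g := strongEpi_of_strongEpi f g
  infer_instance

/-- A generalized element of the target of a regular epimorphism lifts after a cover. -/
theorem exists_cover {X Y T : 𝒳} (e : X ⟶ Y) (he : IsRegularEpi e) (t : T ⟶ Y) :
    ∃ (S : 𝒳) (c : S ⟶ T) (s : S ⟶ X), IsRegularEpi c ∧ s ≫ e = c ≫ t :=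
  ⟨pullback e t, pullback.snd e t, pullback.fst e t, inferInstance, pullback.condition⟩

/-- The kernel pair of `g` is covered by pairs of generalized elements of a cover of its domain. -/
theorem exists_cover_kernelPair {X Y Z : 𝒳} (e : X ⟶ Y) (he : IsRegularEpi e) (g : Y ⟶ Z) :
    ∃ (T : 𝒳) (c : T ⟶ pullback g g) (x₀ x₁ : T ⟶ X), IsRegularEpi c ∧
      x₀ ≫ e = c ≫ pullback.fst g g ∧ x₁ ≫ e = c ≫ pullback.snd g g := by
  obtain ⟨S, c₀, s, hc₀, hs⟩ := exists_cover e he (pullback.fst g g)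
  obtain ⟨T, c₁, t, hc₁, ht⟩ := exists_cover e he (c₀ ≫ pullback.snd g g)
  exact ⟨T, c₁ ≫ c₀, c₁ ≫ s, t, isRegularEpi_comp hc₁ hc₀, by simp [hs], by simp [ht]⟩

theorem exists_image {X Y : 𝒳} (f : X ⟶ Y) :
    ∃ (M : 𝒳) (e : X ⟶ M) (m : M ⟶ Y), IsRegularEpi e ∧ Mono m ∧ e ≫ m = f :=
  let F := Regular.strongEpiMonoFactorisation f
  ⟨F.I, F.e, F.m, inferInstance, inferInstance, F.fac⟩

end Regular

/-! ### Kernels, relations and quotients in semi-abelian categories. -/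

section SemiAbelian

variable {𝒳 : Type u} [Category.{v} 𝒳] [HasZeroMorphisms 𝒳] [SemiAbelian 𝒳]

/-- The kernel and the section of a split epimorphism are jointly epic. -/
theorem hom_ext_of_section {R X Z : 𝒳} {d : R ⟶ X} {s : X ⟶ R} (hs : s ≫ d = 𝟙 X) {a b : R ⟶ Z}
    (hk : kernel.ι d ≫ a = kernel.ι d ≫ b) (h : s ≫ a = s ≫ b) : a = b := by
  have hd : IsRegularEpi d := by
    have : IsSplitEpi d := ⟨⟨s, hs⟩⟩
    infer_instance
  have hd' : IsRegularEpi (equalizer.ι a b ≫ d) := by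
    have : IsSplitEpi (equalizer.ι a b ≫ d) := ⟨⟨equalizer.lift s h, by simp [hs]⟩⟩
    infer_instance
  let k : kernel (equalizer.ι a b ≫ d) ⟶ kernel d :=
    kernel.lift d (kernel.ι (equalizer.ι a b ≫ d) ≫ equalizer.ι a b) (by simp)
  have hiso : IsIso k := by
    refine ⟨kernel.lift _ (equalizer.lift (kernel.ι d) hk) (by simp), ?_, ?_⟩
    · rw [← cancel_mono (kernel.ι _), ← cancel_mono (equalizer.ι a b)]
      simp [k]
    · rw [← cancel_mono (kernel.ι _)]
      simp [k]
  -- The equalizer contains both the section and the kernel of `d`, so the Short Five Lemma makes it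
  -- all of `R`.
  have := SemiAbelian.shortFive (equalizer.ι a b ≫ d) d k (equalizer.ι a b) (𝟙 X) hd' hd
    (by simp [k]) (by simp) hiso inferInstance
  exact eq_of_epi_equalizer

/-- The two kernel pair projections agree on the diagonal and, by hypothesis, on the kernel of the
first, so they are equal. -/
theorem mono_of_forall_eq_zero {X Y : 𝒳} (f : X ⟶ Y)
    (h : ∀ ⦃T : 𝒳⦄ (t : T ⟶ X), t ≫ f = 0 → t = 0) : Mono f := by
  refine (IsKernelPair.of_hasPullback f).mono_of_eq_fst_snd ?_
  refine hom_ext_of_section (d := pullback.fst f f) (s := pullback.lift (𝟙 X) (𝟙 X) rfl)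
    (pullback.lift_fst _ _ _) ?_ (by rw [pullback.lift_fst, pullback.lift_snd])
  rw [kernel.condition, h (kernel.ι (pullback.fst f f) ≫ pullback.snd f f)]
  rw [Category.assoc, ← pullback.condition, kernel.condition_assoc, zero_comp]

/-- A regular epimorphism is the cokernel of its kernel. -/
theorem exists_desc_of_kernel {X Y Z : 𝒳} {f : X ⟶ Y} (hf : IsRegularEpi f) (z : X ⟶ Z)
    (h : kernel.ι f ≫ z = 0) : ∃ g : Y ⟶ Z, f ≫ g = z := by
  refine IsRegularEpi.exists_of_isKernelPair f (IsKernelPair.of_hasPullback f) z ?_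
  refine hom_ext_of_section (d := pullback.fst f f) (s := pullback.lift (𝟙 X) (𝟙 X) rfl)
    (pullback.lift_fst _ _ _) ?_ (by rw [pullback.lift_fst_assoc, pullback.lift_snd_assoc])
  have h' : (kernel.ι (pullback.fst f f) ≫ pullback.snd f f) ≫ f = 0 := by
    rw [Category.assoc, ← pullback.condition, kernel.condition_assoc, zero_comp]
  rw [kernel.condition_assoc, zero_comp, ← Category.assoc, ← kernel.lift_ι f _ h', Category.assoc,
    h, comp_zero]

/-- Relations in a semi-abelian category are difunctional. -/
theorem exists_difunctional {M X S T : 𝒳} {m₁ : M ⟶ X} {m₂ : M ⟶ S}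
    (hm : Mono (prod.lift m₁ m₂)) {x x' : T ⟶ X} {s s' : T ⟶ S} {a b c : T ⟶ M}
    (ha₁ : a ≫ m₁ = x) (ha₂ : a ≫ m₂ = s) (hb₁ : b ≫ m₁ = x') (hb₂ : b ≫ m₂ = s)
    (hc₁ : c ≫ m₁ = x') (hc₂ : c ≫ m₂ = s') : ∃ d : T ⟶ M, d ≫ m₁ = x ∧ d ≫ m₂ = s' := by
  -- The relation `y ~ z` on `M` that says `(m₁ y, m₂ z)` lies in `M`. It is reflexive, hence
  -- Euclidean: `b ~ a` and `b ~ c` give `a ~ c`, which is the claim.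
  let j : pullback (prod.map m₁ m₂) (prod.lift m₁ m₂) ⟶ M ⨯ M := pullback.fst _ _
  let w : pullback (prod.map m₁ m₂) (prod.lift m₁ m₂) ⟶ M := pullback.snd _ _
  have hjw : j ≫ prod.map m₁ m₂ = w ≫ prod.lift m₁ m₂ := pullback.condition
  have hw₁ : w ≫ m₁ = j ≫ prod.fst ≫ m₁ := by
    have := congrArg (· ≫ prod.fst) hjw
    simpa [prod.lift_fst, prod.lift_snd] using this.symm
  have hw₂ : w ≫ m₂ = j ≫ prod.snd ≫ m₂ := by
    have := congrArg (· ≫ prod.snd) hjw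
    simpa [prod.lift_fst, prod.lift_snd] using this.symm
  have hj : Mono j := inferInstance
  have mk : ∀ {T' : 𝒳} (y z e : T' ⟶ M), e ≫ m₁ = y ≫ m₁ → e ≫ m₂ = z ≫ m₂ →
      ∃ l : T' ⟶ pullback (prod.map m₁ m₂) (prod.lift m₁ m₂),
        l ≫ j ≫ prod.fst = y ∧ l ≫ j ≫ prod.snd = z := fun y z e h₁ h₂ =>
    ⟨pullback.lift (prod.lift y z) e
      (by ext <;> simp [h₁, h₂, prod.lift_fst, prod.lift_snd]),
      by simp [j, pullback.lift_fst_assoc, prod.lift_fst],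
      by simp [j, pullback.lift_fst_assoc, prod.lift_snd]⟩
  obtain ⟨r, hr₁, hr₂⟩ := mk (𝟙 M) (𝟙 M) (𝟙 M) rfl rfl
  obtain ⟨τ, hτ₁, hτ₂⟩ := exists_euclid (j ≫ prod.fst) (j ≫ prod.snd)
    (fun T' y z h₁ h₂ => by
      rw [← cancel_mono j]
      ext
      · simpa using h₁
      · simpa using h₂) r hr₁ hr₂
  obtain ⟨l, hl₁, hl₂⟩ := mk b a b rfl (hb₂.trans ha₂.symm)
  obtain ⟨l', hl'₁, hl'₂⟩ := mk b c c (hc₁.trans hb₁.symm) rfl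
  have hll : l ≫ j ≫ prod.fst = l' ≫ j ≫ prod.fst := hl₁.trans hl'₁.symm
  refine ⟨pullback.lift l l' hll ≫ τ ≫ w, ?_, ?_⟩
  · have := congrArg (pullback.lift l l' hll ≫ · ≫ m₁) hτ₁
    simp only [Category.assoc, pullback.lift_fst_assoc] at this
    simp only [Category.assoc, hw₁]
    rw [this, ← ha₁, ← hl₂]
    simp
  · have := congrArg (pullback.lift l l' hll ≫ · ≫ m₂) hτ₂
    simp only [Category.assoc, pullback.lift_snd_assoc] at this
    simp only [Category.assoc, hw₂]
    rw [this, ← hc₂, ← hl'₂]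
    simp

/-- An equivalence relation is the kernel pair of a regular epimorphism. -/
theorem exists_isRegularEpi_isKernelPair {R Y : 𝒳} (p₁ p₂ : R ⟶ Y)
    (hm : ∀ ⦃T : 𝒳⦄ (a b : T ⟶ R), a ≫ p₁ = b ≫ p₁ → a ≫ p₂ = b ≫ p₂ → a = b)
    (r : Y ⟶ R) (h₁ : r ≫ p₁ = 𝟙 Y) (h₂ : r ≫ p₂ = 𝟙 Y) :
    ∃ (Z : 𝒳) (q : Y ⟶ Z), IsRegularEpi q ∧ IsKernelPair q p₁ p₂ := by
  obtain ⟨Z, q, hq⟩ := SemiAbelian.exact p₁ p₂ (isEquivalenceRelation_of_refl p₁ p₂ hm r h₁ h₂)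
  obtain ⟨M, e, m, he, hm', rfl⟩ := exists_image q
  exact ⟨M, e, he, IsKernelPair.cancel_right_of_mono hq⟩

/-- The normalization of a reflexive relation contains the kernel of its own cokernel. -/
theorem exists_lift_of_reflexive {R Y Z T : 𝒳} {d₀ d₁ : R ⟶ Y}
    (hm : ∀ ⦃T : 𝒳⦄ (a b : T ⟶ R), a ≫ d₀ = b ≫ d₀ → a ≫ d₁ = b ≫ d₁ → a = b)
    (r : Y ⟶ R) (h₀ : r ≫ d₀ = 𝟙 Y) (h₁ : r ≫ d₁ = 𝟙 Y) (q : Y ⟶ Z)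
    (hq : ∀ ⦃W : 𝒳⦄ (y : Y ⟶ W), (kernel.ι d₀ ≫ d₁) ≫ y = 0 → ∃ w, q ≫ w = y)
    (t : T ⟶ Y) (ht : t ≫ q = 0) : ∃ s : T ⟶ kernel d₀, s ≫ kernel.ι d₀ ≫ d₁ = t := by
  obtain ⟨W, y, -, hy⟩ := exists_isRegularEpi_isKernelPair d₀ d₁ hm r h₀ h₁
  obtain ⟨w, rfl⟩ := hq y (by rw [Category.assoc, ← hy.w, kernel.condition_assoc, zero_comp])
  -- Since `t` dies in the quotient `y`, the pair `(0, t)` belongs to its kernel pair, which is `R`.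
  refine ⟨kernel.lift d₀ (hy.lift 0 t (by simp [reassoc_of% ht])) (by simp), by simp⟩

end SemiAbelian

/-! ### The unit of a reflection and its kernel. -/

section Unit

variable {𝒳 : Type*} {𝒟 : Type*} [Category 𝒳] [Category 𝒟] (i : 𝒟 ⥤ 𝒳) [Reflective i]

theorem exists_unitMap_comp {X : 𝒳} {D : 𝒟} (g : X ⟶ i.obj D) :
    ∃ h, unitMap i X ≫ i.map h = g :=
  ⟨((reflectorAdjunction i).homEquiv X D).symm g, by
    simpa only [Adjunction.homEquiv_unit, unitMap] using
      ((reflectorAdjunction i).homEquiv X D).apply_symm_apply g⟩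

/-- The essential image of `i` is closed under subobjects and regular quotients. -/
structure IsBirkhoffFunctor : Prop where
  subobject {X : 𝒳} {D : 𝒟} (m : X ⟶ i.obj D) : Mono m → i.essImage X
  quotient {Y : 𝒳} {D : 𝒟} (e : i.obj D ⟶ Y) : IsRegularEpi e → i.essImage Y

variable [HasZeroMorphisms 𝒳]

/-- A perfect object has no nonzero morphism to the reflective subcategory. -/
theorem IsPerfect.eq_zero {X : 𝒳} (h : IsPerfect i X) {D : 𝒟} (g : X ⟶ i.obj D) : g = 0 := by
  obtain ⟨k, rfl⟩ := exists_unitMap_comp i g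
  have ht : IsTerminal (i.obj ((reflector i).obj X)) :=
    IsTerminal.isTerminalObj i _ (IsZero.isTerminal h)
  rw [ht.hom_ext (unitMap i X) 0, zero_comp]

theorem zeroCommι_comp [HasFiniteLimits 𝒳] {X : 𝒳} {D : 𝒟} (g : X ⟶ i.obj D) :
    zeroCommι i X ≫ g = 0 := by
  obtain ⟨k, rfl⟩ := exists_unitMap_comp i g
  rw [zeroCommι, kernel.condition_assoc, zero_comp]

theorem exists_comp_zeroCommι [HasFiniteLimits 𝒳] {X T : 𝒳} (t : T ⟶ X)
    (h : ∀ (D : 𝒟) (g : X ⟶ i.obj D), t ≫ g = 0) : ∃ l, l ≫ zeroCommι i X = t :=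
  ⟨kernel.lift _ t (h _ _), kernel.lift_ι _ _ _⟩

instance [HasFiniteLimits 𝒳] (X : 𝒳) : Mono (zeroCommι i X) :=
  inferInstanceAs (Mono (kernel.ι _))

theorem zeroCommMap_comp [HasFiniteLimits 𝒳] {X Y Z : 𝒳} (f : X ⟶ Y) (g : Y ⟶ Z) :
    zeroCommMap i (f ≫ g) = zeroCommMap i f ≫ zeroCommMap i g := by
  rw [← cancel_mono (zeroCommι i Z), Category.assoc, zeroCommMap_zeroCommι, zeroCommMap_zeroCommι,
    ← Category.assoc (zeroCommMap i f), zeroCommMap_zeroCommι, Category.assoc]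

theorem zeroCommMap_zeroCommι_self [HasFiniteLimits 𝒳] (X : 𝒳) :
    zeroCommMap i (zeroCommι i X) = zeroCommι i (zeroComm i X) := by
  rw [← cancel_mono (zeroCommι i X), zeroCommMap_zeroCommι]

end Unit

/-! ### Trivial and central extensions in terms of commutators. -/

section Birkhoff

variable {𝒳 : Type u} [Category.{v} 𝒳] [HasZeroMorphisms 𝒳] [SemiAbelian 𝒳]
  {𝒟 : Type*} [Category 𝒟] {i : 𝒟 ⥤ 𝒳} [Reflective i]

/-- The image of the unit is a subobject of a reflected object, so the unit factors through it and
its inclusion acquires a section. -/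
theorem IsBirkhoffFunctor.isRegularEpi_unitMap (hi : IsBirkhoffFunctor i) (X : 𝒳) :
    IsRegularEpi (unitMap i X) := by
  obtain ⟨M, e, m, he, hm, h⟩ := exists_image (unitMap i X)
  obtain ⟨D, ⟨φ⟩⟩ := hi.subobject m hm
  obtain ⟨k, hk⟩ := exists_unitMap_comp i (e ≫ φ.inv)
  have h' : (i.map k ≫ φ.hom) ≫ m = 𝟙 _ := by
    have : unitMap i X ≫ i.map (k ≫ i.preimage (φ.hom ≫ m)) = unitMap i X ≫ i.map (𝟙 _) := by
      simp [reassoc_of% hk, h]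
    have := ((reflectorAdjunction i).homEquiv X _).injective
      (a₁ := k ≫ i.preimage (φ.hom ≫ m)) (a₂ := 𝟙 _)
      (by simpa only [Adjunction.homEquiv_unit, unitMap] using this)
    simpa using congrArg i.map this
  have : IsSplitEpi m := ⟨⟨i.map k ≫ φ.hom, h'⟩⟩
  rw [← h]
  exact isRegularEpi_comp he inferInstance

/-- The commutator `[-, -]` preserves regular epimorphisms. -/
theorem IsBirkhoffFunctor.isRegularEpi_zeroCommMap (hi : IsBirkhoffFunctor i) {X Y : 𝒳}
    {f : X ⟶ Y} (hf : IsRegularEpi f) : IsRegularEpi (zeroCommMap i f) := by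
  let x₀ := pullback.fst (unitMap i X) (unitMap i X)
  let x₁ := pullback.snd (unitMap i X) (unitMap i X)
  obtain ⟨δ, hδ₀, hδ₁⟩ : ∃ δ, δ ≫ x₀ = 𝟙 X ∧ δ ≫ x₁ = 𝟙 X :=
    ⟨pullback.lift (𝟙 X) (𝟙 X) rfl, pullback.lift_fst _ _ _, pullback.lift_snd _ _ _⟩
  -- The direct image of the kernel pair of the unit is a kernel pair.
  obtain ⟨S, e, m, he, hm, hem⟩ := exists_image (prod.lift (x₀ ≫ f) (x₁ ≫ f))
  have he₀ : e ≫ m ≫ prod.fst = x₀ ≫ f := by rw [reassoc_of% hem, prod.lift_fst]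
  have he₁ : e ≫ m ≫ prod.snd = x₁ ≫ f := by rw [reassoc_of% hem, prod.lift_snd]
  obtain ⟨r, hr⟩ := exists_lift_of_cover hf hm (s := δ ≫ e) (y := prod.lift (𝟙 Y) (𝟙 Y)) (by
    rw [Category.assoc, hem]
    ext <;> simp [prod.lift_fst, prod.lift_snd, reassoc_of% hδ₀, reassoc_of% hδ₁])
  obtain ⟨Z, q, hq, hqk⟩ := exists_isRegularEpi_isKernelPair (m ≫ prod.fst) (m ≫ prod.snd)
    (fun T a b h h' => by
      rw [← cancel_mono m]
      ext
      · simpa using h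
      · simpa using h') r (by rw [reassoc_of% hr, prod.lift_fst])
      (by rw [reassoc_of% hr, prod.lift_snd])
  have hη := hi.isRegularEpi_unitMap X
  obtain ⟨g, hg⟩ := IsRegularEpi.exists_of_isKernelPair (unitMap i X)
    (IsKernelPair.of_hasPullback _) (f ≫ q) (by
      change x₀ ≫ f ≫ q = x₁ ≫ f ≫ q
      rw [← Category.assoc, ← Category.assoc, ← he₀, ← he₁, Category.assoc e,
        Category.assoc e, hqk.w])
  have hgr : IsRegularEpi g := isRegularEpi_of_comp (hg ▸ isRegularEpi_comp hf hq)
  -- `Z` is a quotient of the reflection of `X`, so `q` kills `[Y, Y]`, and `(0, y)` lies in the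
  -- direct image for every `y` in `[Y, Y]`.
  obtain ⟨D, ⟨φ⟩⟩ := hi.quotient g hgr
  have hvq : zeroCommι i Y ≫ q = 0 := by
    rw [← cancel_mono φ.inv, Category.assoc, zeroCommι_comp, zero_comp]
  let w := hqk.lift 0 (zeroCommι i Y) (by rw [hvq, zero_comp])
  obtain ⟨T, c, z, hc, hz⟩ := exists_cover e he w
  have hz₀ : z ≫ x₀ ≫ f = 0 := by
    rw [← he₀, reassoc_of% hz, hqk.lift_fst, comp_zero]
  have hz₁ : z ≫ x₁ ≫ f = c ≫ zeroCommι i Y := by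
    rw [← he₁, reassoc_of% hz, hqk.lift_snd]
  -- The preimage `(x₀, x₁)` of `(0, y)` need not have `x₀ = 0`. In the relation of pairs `(x₀, f
  -- x₁)`, difunctionality applied to `(0, 0)`, `(x₀, 0)`, `(x₀, y)` yields `(0, y)`, hence an
  -- element of `[X, X]` over `y`.
  obtain ⟨M, e', m', he', hm', hem'⟩ := exists_image (prod.lift x₀ (x₁ ≫ f))
  have he'₀ : e' ≫ m' ≫ prod.fst = x₀ := by rw [reassoc_of% hem', prod.lift_fst]
  have he'₁ : e' ≫ m' ≫ prod.snd = x₁ ≫ f := by rw [reassoc_of% hem', prod.lift_snd]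
  obtain ⟨d, hd₀, hd₁⟩ := exists_difunctional (m₁ := m' ≫ prod.fst) (m₂ := m' ≫ prod.snd)
    (by
      have : prod.lift (m' ≫ prod.fst) (m' ≫ prod.snd) = m' := by
        ext <;> simp [prod.lift_fst, prod.lift_snd]
      rwa [this]) (T := T) (a := 0) (x := 0) (s := 0) (b := z ≫ x₀ ≫ δ ≫ e') (c := z ≫ e')
    (x' := z ≫ x₀) (s' := c ≫ zeroCommι i Y) (by simp) (by simp)
    (by simp [he'₀, hδ₀]) (by simp [he'₁, reassoc_of% hδ₁, hz₀]) (by simp [he'₀])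
    (by simp [he'₁, hz₁])
  obtain ⟨T', c', z', hc', hz'⟩ := exists_cover e' he' d
  have hz'₀ : z' ≫ x₀ = 0 := by rw [← he'₀, reassoc_of% hz', hd₀, comp_zero]
  have hz'₁ : z' ≫ x₁ ≫ f = c' ≫ c ≫ zeroCommι i Y := by rw [← he'₁, reassoc_of% hz', hd₁]
  have hl : (z' ≫ x₁) ≫ unitMap i X = 0 := by
    have : x₀ ≫ unitMap i X = x₁ ≫ unitMap i X := pullback.condition
    rw [Category.assoc, ← this, reassoc_of% hz'₀, zero_comp]
  have hl' : kernel.lift _ (z' ≫ x₁) hl ≫ zeroCommMap i f = c' ≫ c := by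
    rw [← cancel_mono (zeroCommι i Y), Category.assoc, zeroCommMap_zeroCommι, zeroCommι,
      kernel.lift_ι_assoc]
    simpa using hz'₁
  exact isRegularEpi_of_comp (hl' ▸ isRegularEpi_comp hc' hc)

theorem IsTrivialExt.mono_zeroCommMap {B A : 𝒳} {f : B ⟶ A} (h : IsTrivialExt i f) :
    Mono (zeroCommMap i f) := by
  refine mono_of_forall_eq_zero _ fun T t ht => ?_
  rw [← cancel_mono (zeroCommι i B), zero_comp]
  refine h.2.hom_ext ?_ ?_
  · rw [Category.assoc, ← zeroCommMap_zeroCommι, reassoc_of% ht, zero_comp, zero_comp]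
  · rw [Category.assoc, zeroCommι, kernel.condition, comp_zero, zero_comp]

/-- Here `[f, f]` is an isomorphism, so `B` and the pullback have the same kernel over the
reflection of `B`; the Short Five Lemma identifies them. -/
theorem IsBirkhoffFunctor.isTrivialExt (hi : IsBirkhoffFunctor i) {B A : 𝒳} {f : B ⟶ A}
    (hf : IsRegularEpi f) (hm : Mono (zeroCommMap i f)) : IsTrivialExt i f := by
  have hiso : IsIso (zeroCommMap i f) :=
    isIso_of_isRegularEpi_of_mono (hi.isRegularEpi_zeroCommMap hf) hm
  have hw : f ≫ unitMap i A = unitMap i B ≫ i.map ((reflector i).map f) :=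
    (reflectorAdjunction i).unit.naturality f
  let c : B ⟶ pullback (unitMap i A) (i.map ((reflector i).map f)) :=
    pullback.lift f (unitMap i B) hw
  have hc₁ : c ≫ pullback.fst _ _ = f := pullback.lift_fst _ _ _
  have hc₂ : c ≫ pullback.snd _ _ = unitMap i B := pullback.lift_snd _ _ _
  have hη := hi.isRegularEpi_unitMap
  have := hη A
  let s := pullback.snd (unitMap i A) (i.map ((reflector i).map f))
  let k : kernel (unitMap i B) ⟶ kernel s := kernel.lift _ (kernel.ι _ ≫ c) (by simp [s, hc₂])
  let n : kernel s ⟶ zeroComm i A := kernel.lift _ (kernel.ι s ≫ pullback.fst _ _) (by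
    rw [Category.assoc, pullback.condition, kernel.condition_assoc, zero_comp])
  have hkn : k ≫ n = zeroCommMap i f := by
    rw [← cancel_mono (zeroCommι i A), zeroCommMap_zeroCommι]
    simp [k, n, zeroCommι, hc₁]
  have hn : Mono n := by
    refine mono_of_forall_eq_zero _ fun T t ht => ?_
    rw [← cancel_mono (kernel.ι s)]
    apply pullback.hom_ext
    · have : n ≫ zeroCommι i A = kernel.ι s ≫ pullback.fst _ _ := kernel.lift_ι _ _ _
      rw [Category.assoc, ← this, reassoc_of% ht, zero_comp, zero_comp, zero_comp]
    · rw [Category.assoc, kernel.condition, comp_zero, zero_comp, zero_comp]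
  have hk : IsIso k := by
    refine ⟨n ≫ inv (zeroCommMap i f), ?_, ?_⟩
    · rw [reassoc_of% hkn, IsIso.hom_inv_id]
    · rw [← cancel_mono n, Category.assoc, Category.assoc, hkn, IsIso.inv_hom_id]
      simp
  have hciso : IsIso c := SemiAbelian.shortFive (unitMap i B) s k c (𝟙 _) (hη B) inferInstance
    (by simp [k]) (by simp [s, hc₂]) hk inferInstance
  exact ⟨hf, IsPullback.of_iso_pullback ⟨hw⟩ (asIso c) hc₁ hc₂⟩

/-- Morphisms that agree after composition with a central extension induce the same morphism on
commutators. -/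
theorem IsBirkhoffFunctor.zeroCommMap_eq (hi : IsBirkhoffFunctor i) {B A T : 𝒳} {f : B ⟶ A}
    (hf : IsCentralExt i f) {a b : T ⟶ B} (h : a ≫ f = b ≫ f) :
    zeroCommMap i a = zeroCommMap i b := by
  obtain ⟨-, C, g, hg, ht⟩ := hf
  have hm := ht.mono_zeroCommMap
  let c := pullback.fst (a ≫ f) g
  have hc : IsRegularEpi c := inferInstance
  have hca : (c ≫ a) ≫ f = pullback.snd (a ≫ f) g ≫ g := by
    rw [Category.assoc, pullback.condition]
  have hcb : (c ≫ b) ≫ f = pullback.snd (a ≫ f) g ≫ g := by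
    rw [Category.assoc, ← h, pullback.condition]
  -- After a cover both morphisms lift to the trivial pullback with the same second component, and
  -- that projection is monic on commutators.
  have heq : zeroCommMap i (pullback.lift _ _ hca) = zeroCommMap i (pullback.lift _ _ hcb) := by
    rw [← cancel_mono (zeroCommMap i (pullback.snd f g)), ← zeroCommMap_comp, ← zeroCommMap_comp,
      pullback.lift_snd, pullback.lift_snd]
  have := hi.isRegularEpi_zeroCommMap hc
  rw [← cancel_epi (zeroCommMap i c), ← zeroCommMap_comp, ← zeroCommMap_comp,
    ← pullback.lift_fst _ _ hca, ← pullback.lift_fst _ _ hcb, zeroCommMap_comp,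
    zeroCommMap_comp _ (pullback.lift _ _ hcb), heq]

/-- Such an `f` is trivialized by itself: an element of the commutator of the kernel pair killed by
one projection is killed by the other. An arbitrary kernel pair is allowed so that the image of one
under `ℬ.ι` can be used. -/
theorem IsBirkhoffFunctor.isCentralExt (hi : IsBirkhoffFunctor i) {B A R : 𝒳} {f : B ⟶ A}
    (hf : IsRegularEpi f) {f₀ f₁ : R ⟶ B} (hk : IsKernelPair f f₀ f₁)
    (h : zeroCommMap i f₀ = zeroCommMap i f₁) : IsCentralExt i f := by
  refine ⟨hf, B, f, hf, hi.isTrivialExt inferInstance ?_⟩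
  have heq : zeroCommMap i (pullback.fst f f) = zeroCommMap i (pullback.snd f f) := by
    rw [← hk.lift_fst _ _ (pullback.condition (f := f) (g := f)), zeroCommMap_comp, h,
      ← zeroCommMap_comp, hk.lift_snd]
  refine mono_of_forall_eq_zero _ fun T t ht => ?_
  rw [← cancel_mono (zeroCommι i _), zero_comp]
  apply pullback.hom_ext
  · rw [Category.assoc, ← zeroCommMap_zeroCommι, heq, reassoc_of% ht, zero_comp, zero_comp]
  · rw [Category.assoc, ← zeroCommMap_zeroCommι, reassoc_of% ht, zero_comp, zero_comp]

end Birkhoff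

/-! ### The universal central extension and the Hopf formula. -/

section Baer

variable {𝒳 : Type u} [Category.{v} 𝒳] [HasZeroMorphisms 𝒳] [SemiAbelian 𝒳]
  {𝒟 : Type*} [Category 𝒟] {i : 𝒟 ⥤ 𝒳} [Reflective i]

theorem isRegularEpi_cokernelπ {X Y : 𝒳} (f : X ⟶ Y) : IsRegularEpi (cokernel.π f) :=
  inferInstanceAs (IsRegularEpi (coequalizer.π f 0))

theorem zeroCommMap_section_fst {P A : 𝒳} (p : P ⟶ A) :
    zeroCommMap i (pullback.lift (𝟙 P) (𝟙 P) rfl) ≫ zeroCommMap i (pullback.fst p p) = 𝟙 _ := by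
  rw [← cancel_mono (zeroCommι i P), Category.assoc, zeroCommMap_zeroCommι, ← Category.assoc,
    zeroCommMap_zeroCommι, Category.assoc, pullback.lift_fst, Category.comp_id, Category.id_comp]

theorem zeroCommMap_section_snd {P A : 𝒳} (p : P ⟶ A) :
    zeroCommMap i (pullback.lift (𝟙 P) (𝟙 P) rfl) ≫ zeroCommMap i (pullback.snd p p) = 𝟙 _ := by
  rw [← cancel_mono (zeroCommι i P), Category.assoc, zeroCommMap_zeroCommι, ← Category.assoc,
    zeroCommMap_zeroCommι, Category.assoc, pullback.lift_snd, Category.comp_id, Category.id_comp]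

/-- The quotient `[P, P] ⟶ U(A, I)` coequalizes the two morphisms induced by any two morphisms
that agree after composition with `p`. -/
theorem zeroCommMap_comp_cokernelπ {P A T : 𝒳} (p : P ⟶ A) {a b : T ⟶ P} (h : a ≫ p = b ≫ p) :
    zeroCommMap i a ≫ cokernel.π (relCommι i p) = zeroCommMap i b ≫ cokernel.π (relCommι i p) := by
  have key : zeroCommMap i (pullback.fst p p) ≫ cokernel.π (relCommι i p) =
      zeroCommMap i (pullback.snd p p) ≫ cokernel.π (relCommι i p) := by
    refine hom_ext_of_section (zeroCommMap_section_fst p) ?_ ?_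
    · rw [kernel.condition_assoc, zero_comp, ← Category.assoc]
      exact (cokernel.condition (relCommι i p)).symm
    · rw [← Category.assoc, ← Category.assoc, zeroCommMap_section_fst, zeroCommMap_section_snd]
  rw [← pullback.lift_fst a b h, zeroCommMap_comp, Category.assoc, key, ← Category.assoc,
    ← zeroCommMap_comp, pullback.lift_snd]

theorem cokernelπ_baerUMap {P A : 𝒳} (p : P ⟶ A) :
    cokernel.π (relCommι i p) ≫ baerUMap i p = zeroCommι i P ≫ p :=
  cokernel.π_desc _ _ _

/-- The relative commutator is the full kernel of `[P, P] ⟶ U(A, I)`. -/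
theorem exists_comp_relCommι {P A T : 𝒳} (p : P ⟶ A) (t : T ⟶ zeroComm i P)
    (ht : t ≫ cokernel.π (relCommι i p) = 0) : ∃ s, s ≫ relCommι i p = t := by
  refine exists_lift_of_reflexive (d₀ := zeroCommMap i (pullback.fst p p))
    (d₁ := zeroCommMap i (pullback.snd p p)) (fun T a b h₀ h₁ => ?_) _
    (zeroCommMap_section_fst p) (zeroCommMap_section_snd p) _
    (fun W y hy => ⟨cokernel.desc _ y hy, cokernel.π_desc _ _ _⟩) t ht
  rw [← cancel_mono (zeroCommι i _)]
  apply pullback.hom_ext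
  · simpa [zeroCommMap_zeroCommι] using congrArg (· ≫ zeroCommι i P) h₀
  · simpa [zeroCommMap_zeroCommι] using congrArg (· ≫ zeroCommι i P) h₁

theorem cokernelπ_hopfH2ι {P A : 𝒳} (p : P ⟶ A) :
    cokernel.π (relCommToKerInf i p) ≫ hopfH2ι i p = kerInfι i p ≫ cokernel.π (relCommι i p) :=
  cokernel.π_desc _ _ _

theorem hopfH2ι_baerUMap {P A : 𝒳} (p : P ⟶ A) : hopfH2ι i p ≫ baerUMap i p = 0 := by
  have := isRegularEpi_cokernelπ (relCommToKerInf i p)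
  have h : kerInfι i p ≫ zeroCommι i P = pullback.fst _ _ ≫ kernel.ι p := pullback.condition.symm
  rw [← cancel_epi (cokernel.π (relCommToKerInf i p)), ← Category.assoc, cokernelπ_hopfH2ι,
    Category.assoc, cokernelπ_baerUMap, reassoc_of% h, kernel.condition, comp_zero, comp_zero]

/-- An element of `K ∧ [P, P]` vanishing in `U` lies in `[K, P]`, by `exists_comp_relCommι`. -/
instance mono_hopfH2ι {P A : 𝒳} (p : P ⟶ A) : Mono (hopfH2ι i p) := by
  refine mono_of_forall_eq_zero _ fun T t ht => ?_
  have hm : Mono (kerInfι i p) := inferInstanceAs (Mono (pullback.snd _ _))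
  obtain ⟨S, c, s, hc, hs⟩ := exists_cover _ (isRegularEpi_cokernelπ (relCommToKerInf i p)) t
  obtain ⟨r, hr⟩ := exists_comp_relCommι p (s ≫ kerInfι i p) (by
    rw [Category.assoc, ← cokernelπ_hopfH2ι, reassoc_of% hs, ht, comp_zero])
  have hr' : r ≫ relCommToKerInf i p = s := by
    rw [← cancel_mono (kerInfι i p), Category.assoc, relCommToKerInf_kerInfι, hr]
  rw [← cancel_epi c, ← hs, ← hr', Category.assoc, cokernel.condition, comp_zero, comp_zero]

/-- The Hopf formula computes the kernel of `U(A, I) ⟶ A`. -/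
theorem exists_comp_hopfH2ι {P A T : 𝒳} (p : P ⟶ A) (t : T ⟶ baerU i p)
    (ht : t ≫ baerUMap i p = 0) : ∃ l, l ≫ hopfH2ι i p = t := by
  obtain ⟨S, c, s, hc, hs⟩ := exists_cover _ (isRegularEpi_cokernelπ (relCommι i p)) t
  have h : (s ≫ zeroCommι i P) ≫ p = 0 := by
    rw [Category.assoc, ← cokernelπ_baerUMap, reassoc_of% hs, ht, comp_zero]
  let w : S ⟶ kerInf i p := pullback.lift (kernel.lift p _ h) s (kernel.lift_ι _ _ _)
  refine exists_lift_of_cover hc inferInstance (s := w ≫ cokernel.π _) ?_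
  rw [Category.assoc, cokernelπ_hopfH2ι, ← hs, ← Category.assoc]
  congr 1
  exact pullback.lift_snd _ _ _

/-- The assumption on `A` means `[A, A] = A`, and `[p, p]` is a regular epimorphism. -/
theorem IsBirkhoffFunctor.isRegularEpi_zeroCommι_comp (hi : IsBirkhoffFunctor i)
    {P A : 𝒳} {p : P ⟶ A} (hp : IsRegularEpi p) (hA : ∀ (D : 𝒟) (g : A ⟶ i.obj D), g = 0) :
    IsRegularEpi (zeroCommι i P ≫ p) := by
  obtain ⟨s, hs⟩ := exists_comp_zeroCommι i (𝟙 A) fun D g => by simp [hA D g]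
  have : IsSplitEpi (zeroCommι i A) := ⟨⟨s, hs⟩⟩
  rw [← zeroCommMap_zeroCommι]
  exact isRegularEpi_comp (hi.isRegularEpi_zeroCommMap hp) inferInstance

theorem IsBirkhoffFunctor.isCentralExt_baerUMap (hi : IsBirkhoffFunctor i)
    {P A : 𝒳} {p : P ⟶ A} (hp : IsRegularEpi p) (hA : ∀ (D : 𝒟) (g : A ⟶ i.obj D), g = 0) :
    IsCentralExt i (baerUMap i p) := by
  let q := cokernel.π (relCommι i p)
  let u := baerUMap i p
  have hq : IsRegularEpi q := isRegularEpi_cokernelπ _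
  have hqu : q ≫ u = zeroCommι i P ≫ p := cokernelπ_baerUMap p
  have hu : IsRegularEpi u :=
    isRegularEpi_of_comp (hqu ▸ hi.isRegularEpi_zeroCommι_comp hp hA)
  refine hi.isCentralExt hu (IsKernelPair.of_hasPullback u) ?_
  let u₀ := pullback.fst u u
  let u₁ := pullback.snd u u
  obtain ⟨T, c, x₀, x₁, hc, h₀, h₁⟩ := exists_cover_kernelPair q hq u
  change x₀ ≫ q = c ≫ u₀ at h₀
  change x₁ ≫ q = c ≫ u₁ at h₁
  have hcc : x₀ ≫ zeroCommι i P ≫ p = x₁ ≫ zeroCommι i P ≫ p := by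
    rw [← hqu, ← Category.assoc, h₀, ← Category.assoc, h₁, Category.assoc c u₀,
      Category.assoc c u₁, (pullback.condition : u₀ ≫ u = u₁ ≫ u)]
  -- The identity `[μ, μ] = μ` on `[[P, P], [P, P]]` turns this into the equality of `x₀ ≫ q` and
  -- `x₁ ≫ q` on `[T, T]`.
  have key := zeroCommMap_comp_cokernelπ (i := i) p (a := x₀ ≫ zeroCommι i P)
    (b := x₁ ≫ zeroCommι i P) (by simpa using hcc)
  rw [zeroCommMap_comp, zeroCommMap_comp i x₁, zeroCommMap_zeroCommι_self, zeroCommMap_zeroCommι,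
    zeroCommMap_zeroCommι] at key
  have := hi.isRegularEpi_zeroCommMap hc
  rw [← cancel_epi (zeroCommMap i c), ← cancel_mono (zeroCommι i _)]
  change (zeroCommMap i c ≫ zeroCommMap i u₀) ≫ _ = (zeroCommMap i c ≫ zeroCommMap i u₁) ≫ _
  rw [← zeroCommMap_comp, ← zeroCommMap_comp, ← h₀, ← h₁, zeroCommMap_zeroCommι,
    zeroCommMap_zeroCommι]
  simpa using key

/-- The object `U(A, I)` is perfect. -/
theorem IsBirkhoffFunctor.isRegularEpi_zeroCommι_baerU (hi : IsBirkhoffFunctor i)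
    {P A : 𝒳} {p : P ⟶ A} (hp : IsRegularEpi p) (hA : ∀ (D : 𝒟) (g : A ⟶ i.obj D), g = 0) :
    IsRegularEpi (zeroCommι i (baerU i p)) := by
  let q := cokernel.π (relCommι i p)
  have hq : IsRegularEpi q := isRegularEpi_cokernelπ _
  have hr := hi.isRegularEpi_zeroCommι_comp hp hA
  -- As `[P, P]` covers `A`, each element of `P` agrees over `A`, after a cover, with one of `[P,
  -- P]`. So `[c, c] ≫ q` can be computed through `[[P, P], [P, P]]`, and there it factors through
  -- `[U, U]`.
  let c := pullback.snd (zeroCommι i P ≫ p) p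
  have hc : IsRegularEpi c := inferInstance
  have h : (pullback.fst (zeroCommι i P ≫ p) p ≫ zeroCommι i P) ≫ p = c ≫ p := by
    rw [Category.assoc, pullback.condition]
  have key := zeroCommMap_comp_cokernelπ (i := i) p h
  have h' : zeroCommι i (zeroComm i P) ≫ q = zeroCommMap i q ≫ zeroCommι i (baerU i p) :=
    (zeroCommMap_zeroCommι i q).symm
  rw [zeroCommMap_comp, zeroCommMap_zeroCommι_self, Category.assoc, h', ← Category.assoc] at key
  exact isRegularEpi_of_comp (key ▸ isRegularEpi_comp (hi.isRegularEpi_zeroCommMap hc) hq)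

theorem IsBirkhoffFunctor.isUniversalCentralExt_baerUMap (hi : IsBirkhoffFunctor i)
    {P A : 𝒳} {p : P ⟶ A} (hp : IsRegularEpi p) (hA : ∀ (D : 𝒟) (g : A ⟶ i.obj D), g = 0)
    (hP : IsRegProjective P) :
    IsUniversalCentralExt i (baerUMap i p) := by
  refine ⟨hi.isCentralExt_baerUMap hp hA, fun B f hf => ?_⟩
  obtain ⟨h, hh⟩ := hP f p hf.1
  -- Centrality of `f` gives the two kernel pair projections of `p`, followed by `h`, the same
  -- effect on commutators.
  have hw : relCommι i p ≫ zeroCommι i P ≫ h = 0 := by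
    have := hi.zeroCommMap_eq hf (a := pullback.fst p p ≫ h) (b := pullback.snd p p ≫ h)
      (by simp only [Category.assoc, hh, pullback.condition])
    rw [zeroCommMap_comp, zeroCommMap_comp] at this
    rw [← zeroCommMap_zeroCommι, relCommι, Category.assoc, ← Category.assoc (zeroCommMap i _),
      ← this, Category.assoc, kernel.condition_assoc, zero_comp]
  have hq := isRegularEpi_cokernelπ (relCommι i p)
  have hl : cokernel.desc _ _ hw ≫ f = baerUMap i p := by
    rw [← cancel_epi (cokernel.π (relCommι i p)), cokernel.π_desc_assoc, cokernelπ_baerUMap,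
      Category.assoc, hh]
  refine ⟨cokernel.desc _ _ hw, hl, fun k hk => ?_⟩
  have := hi.isRegularEpi_zeroCommι_baerU hp hA
  rw [← cancel_epi (zeroCommι i (baerU i p)), ← zeroCommMap_zeroCommι, ← zeroCommMap_zeroCommι,
    hi.zeroCommMap_eq hf (hk.trans hl.symm)]

end Baer

/-- Pairs in the kernel pair of `g` lift, after a cover, to pairs in that of `e ≫ g`. This transfers
centrality from `U(B, JI)` to its reflection in `ℬ`. -/
theorem IsBirkhoffFunctor.isCentralExt_of_comp {𝒳 : Type u} [Category.{v} 𝒳]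
    [HasZeroMorphisms 𝒳] [SemiAbelian 𝒳] {𝒟 : Type*} [Category 𝒟] {i : 𝒟 ⥤ 𝒳} [Reflective i]
    (hi : IsBirkhoffFunctor i) {X Y A : 𝒳} {e : X ⟶ Y} (he : IsRegularEpi e) {g : Y ⟶ A}
    (h : IsCentralExt i (e ≫ g)) : IsCentralExt i g := by
  refine hi.isCentralExt (isRegularEpi_of_comp h.1) (IsKernelPair.of_hasPullback g) ?_
  obtain ⟨T, c, x₀, x₁, hc, h₀, h₁⟩ := exists_cover_kernelPair e he g
  have := hi.isRegularEpi_zeroCommMap hc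
  rw [← cancel_epi (zeroCommMap i c), ← zeroCommMap_comp, ← zeroCommMap_comp, ← h₀, ← h₁,
    zeroCommMap_comp, zeroCommMap_comp, hi.zeroCommMap_eq h (a := x₀) (b := x₁)]
  rw [← Category.assoc, h₀, ← Category.assoc, h₁, Category.assoc, Category.assoc,
    pullback.condition]

/-! ### Birkhoff subcategories are semi-abelian; centrality in `ℬ` and in `𝒜`. -/

section Subcategory

variable {𝒜 : Type u} [Category.{v} 𝒜] [HasZeroMorphisms 𝒜] [SemiAbelian 𝒜]
  {ℬ : ObjectProperty 𝒜} [Birkhoff ℬ]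

theorem isBirkhoffFunctor_ι {𝒳 : Type u} [Category.{v} 𝒳] (ℬ : ObjectProperty 𝒳) [Birkhoff ℬ] :
    IsBirkhoffFunctor ℬ.ι where
  subobject {X D} m hm := ⟨⟨X, Birkhoff.subobject m hm D.property⟩, ⟨Iso.refl X⟩⟩
  quotient {Y D} e he := ⟨⟨Y, Birkhoff.quotient e he D.property⟩, ⟨Iso.refl Y⟩⟩

theorem isRegularEpi_of_hom {X Y : ℬ.FullSubcategory} {f : X ⟶ Y} (h : IsRegularEpi f.hom) :
    IsRegularEpi f := by
  have : Epi (ℬ.ι.map f) := inferInstanceAs (Epi f.hom)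
  have : Epi f := ℬ.ι.epi_of_epi_map this
  refine IsRegularEpi.of_epi_of_exists fun {W} g hg => ?_
  have hk : IsKernelPair (ℬ.ι.map f) (ℬ.ι.map (pullback.fst f f)) (ℬ.ι.map (pullback.snd f f)) :=
    (IsPullback.of_hasPullback f f).map ℬ.ι
  have : IsRegularEpi (ℬ.ι.map f) := h
  obtain ⟨l, hl⟩ := IsRegularEpi.exists_of_isKernelPair _ hk (ℬ.ι.map g)
    (by rw [← Functor.map_comp, ← Functor.map_comp, hg])
  exact ⟨ℬ.homMk l, ObjectProperty.hom_ext _ hl⟩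

/-- The image formed in `𝒜` stays in `ℬ` by closure under subobjects, so its inclusion is both monic
and strongly epic in `ℬ`. -/
theorem isRegularEpi_hom {X Y : ℬ.FullSubcategory} {f : X ⟶ Y} (h : IsRegularEpi f) :
    IsRegularEpi f.hom := by
  obtain ⟨M, e, m, he, hm, hem⟩ := exists_image f.hom
  let M' : ℬ.FullSubcategory := ⟨M, Birkhoff.subobject m hm Y.property⟩
  let e' : X ⟶ M' := ℬ.homMk e
  let m' : M' ⟶ Y := ℬ.homMk m
  have hem' : e' ≫ m' = f := ObjectProperty.hom_ext _ hem
  have : Mono (ℬ.ι.map m') := hm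
  have : Mono m' := ℬ.ι.mono_of_mono_map this
  have : StrongEpi (e' ≫ m') := by rw [hem']; infer_instance
  have : StrongEpi m' := strongEpi_of_strongEpi e' m'
  have : IsIso m' := isIso_of_mono_of_strongEpi m'
  have : IsIso m := inferInstanceAs (IsIso (ℬ.ι.map m'))
  rw [← hem]
  exact isRegularEpi_comp he inferInstance

/-- Joint monicity in `ℬ` can thereby be tested on objects of `𝒜`. -/
theorem exists_reflection_factorization {T : 𝒜} {X : ℬ.FullSubcategory} {a b : T ⟶ X.obj} :
    ∃ (T' : ℬ.FullSubcategory) (e : T ⟶ T'.obj) (a' b' : T' ⟶ X), IsRegularEpi e ∧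
      e ≫ a'.hom = a ∧ e ≫ b'.hom = b := by
  obtain ⟨a', ha⟩ := exists_unitMap_comp ℬ.ι (D := X) a
  obtain ⟨b', hb⟩ := exists_unitMap_comp ℬ.ι (D := X) b
  exact ⟨_, _, a', b', (isBirkhoffFunctor_ι ℬ).isRegularEpi_unitMap T, ha, hb⟩

theorem regular_fullSubcategory : Regular ℬ.FullSubcategory where
  hasCoequalizer_of_isKernelPair _ := inferInstance
  regularEpiIsStableUnderBaseChange := ⟨fun {X Y Y' S f g f' g'} sq hg => by
    have hg : IsRegularEpi (ℬ.ι.map g) := isRegularEpi_hom hg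
    exact isRegularEpi_of_hom
      (Regular.regularEpiIsStableUnderBaseChange.of_isPullback (sq.map ℬ.ι) hg)⟩

theorem semiAbelian_fullSubcategory : SemiAbelian ℬ.FullSubcategory where
  toRegular := regular_fullSubcategory
  zero := by
    obtain ⟨Z, hZ⟩ := HasZeroObject.zero (C := 𝒜)
    let Z' : ℬ.FullSubcategory := ⟨Z, Birkhoff.subobject
      (0 : Z ⟶ ℬ.ι.obj ((reflector ℬ.ι).obj Z)) ⟨fun _ _ _ => hZ.eq_of_tgt _ _⟩ (ℬ.prop_ι_obj _)⟩
    exact ⟨Z', (IsZero.iff_id_eq_zero Z').mpr (ObjectProperty.hom_ext _ (hZ.eq_of_src _ _))⟩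
  has_colimit := (hasColimitsOfShape_of_reflective ℬ.ι :
    HasColimitsOfShape (Discrete WalkingPair) ℬ.FullSubcategory).has_colimit
  exact {R X} p₁ p₂ h := by
    obtain ⟨⟨E⟩⟩ := h
    obtain ⟨Z, q, hq, hk⟩ := exists_isRegularEpi_isKernelPair p₁.hom p₂.hom
      (fun T a b h₁ h₂ => by
        obtain ⟨T', e, a', b', he, rfl, rfl⟩ := exists_reflection_factorization (a := a) (b := b)
        simp only [Category.assoc, cancel_epi] at h₁ h₂
        rw [E.right_cancellation a' b' (ObjectProperty.hom_ext _ h₁)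
          (ObjectProperty.hom_ext _ h₂)])
      E.r.hom (congrArg (·.hom) E.reflexivity₁) (congrArg (·.hom) E.reflexivity₂)
    let Z' : ℬ.FullSubcategory := ⟨Z, Birkhoff.quotient q hq X.property⟩
    let q' : X ⟶ Z' := ℬ.homMk q
    exact ⟨Z', q', IsPullback.of_map ℬ.ι (ObjectProperty.hom_ext _ hk.w) hk⟩
  shortFive {B' A' B A} f' f k b a hf' hf hk hf'a hki ha := by
    have : ℬ.ι.PreservesZeroMorphisms := ⟨fun _ _ => rfl⟩
    have hiso := SemiAbelian.shortFive (ℬ.ι.map f') (ℬ.ι.map f)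
      ((PreservesKernel.iso ℬ.ι f').inv ≫ ℬ.ι.map k ≫ (PreservesKernel.iso ℬ.ι f).hom)
      (ℬ.ι.map b) (ℬ.ι.map a) (isRegularEpi_hom hf') (isRegularEpi_hom hf) (by
        have h : ∀ {X Y : ℬ.FullSubcategory} (g : X ⟶ Y), (PreservesKernel.iso ℬ.ι g).hom ≫
            kernel.ι (ℬ.ι.map g) = ℬ.ι.map (kernel.ι g) := fun g => by
          rw [PreservesKernel.iso_hom, kernelComparison_comp_ι]
        rw [Category.assoc, Category.assoc, h, Iso.eq_inv_comp, ← Category.assoc, h,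
          ← Functor.map_comp, ← Functor.map_comp, hk]) (by
        rw [← Functor.map_comp, ← Functor.map_comp, hf'a]) inferInstance inferInstance
    exact isIso_of_reflects_iso b ℬ.ι

variable {𝒟 : Type*} [Category 𝒟] {j : 𝒟 ⥤ ℬ.FullSubcategory}

theorem IsBirkhoffFunctor.comp_ι (hj : IsBirkhoffFunctor j) : IsBirkhoffFunctor (j ⋙ ℬ.ι) where
  subobject {X D} m hm := by
    let X' : ℬ.FullSubcategory := ⟨X, Birkhoff.subobject m hm (j.obj D).property⟩
    have : Mono (ℬ.ι.map (ℬ.homMk m : X' ⟶ j.obj D)) := hm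
    obtain ⟨D', ⟨φ⟩⟩ := hj.subobject (ℬ.homMk m : X' ⟶ j.obj D) (ℬ.ι.mono_of_mono_map this)
    exact ⟨D', ⟨ℬ.ι.mapIso φ⟩⟩
  quotient {Y D} e he := by
    let Y' : ℬ.FullSubcategory := ⟨Y, Birkhoff.quotient e he (j.obj D).property⟩
    obtain ⟨D', ⟨φ⟩⟩ := hj.quotient (ℬ.homMk e : j.obj D ⟶ Y') (isRegularEpi_of_hom he)
    exact ⟨D', ⟨ℬ.ι.mapIso φ⟩⟩

variable [Reflective j]

/-- The `JI`-commutator of `R` is a subobject of `R`, hence in `ℬ`, and is killed by all maps to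
objects of `𝒟`; so it lies in the `J`-commutator, where the projections agree. `isCentralExt_of_hom`
uses the reverse inclusion. -/
theorem IsBirkhoffFunctor.isCentralExt_hom (hj : IsBirkhoffFunctor j) {X Y : ℬ.FullSubcategory}
    {f : X ⟶ Y} (h : IsCentralExt j f) : IsCentralExt (j ⋙ ℬ.ι) f.hom := by
  have := semiAbelian_fullSubcategory (ℬ := ℬ)
  refine hj.comp_ι.isCentralExt (isRegularEpi_hom h.1)
    ((IsPullback.of_hasPullback f f).map ℬ.ι) ?_
  let R := pullback f f
  let S : ℬ.FullSubcategory := ⟨zeroComm (j ⋙ ℬ.ι) R.obj,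
    Birkhoff.subobject (zeroCommι (j ⋙ ℬ.ι) R.obj) inferInstance R.property⟩
  let t : S ⟶ R := ℬ.homMk (zeroCommι (j ⋙ ℬ.ι) R.obj)
  obtain ⟨l, hl⟩ := exists_comp_zeroCommι j t fun D g =>
    ObjectProperty.hom_ext _ (zeroCommι_comp (j ⋙ ℬ.ι) (D := D) g.hom)
  have ht : t ≫ pullback.fst f f = t ≫ pullback.snd f f := by
    rw [← hl, Category.assoc, Category.assoc, ← zeroCommMap_zeroCommι, ← zeroCommMap_zeroCommι,
      hj.zeroCommMap_eq h pullback.condition]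
  rw [← cancel_mono (zeroCommι (j ⋙ ℬ.ι) _), zeroCommMap_zeroCommι, zeroCommMap_zeroCommι]
  exact congrArg (·.hom) ht

theorem IsBirkhoffFunctor.isCentralExt_of_hom (hj : IsBirkhoffFunctor j)
    {X Y : ℬ.FullSubcategory} {f : X ⟶ Y} (h : IsCentralExt (j ⋙ ℬ.ι) f.hom) :
    IsCentralExt j f := by
  have := semiAbelian_fullSubcategory (ℬ := ℬ)
  refine hj.isCentralExt (isRegularEpi_of_hom h.1) (IsPullback.of_hasPullback f f) ?_
  let R := pullback f f
  obtain ⟨l, hl⟩ := exists_comp_zeroCommι (j ⋙ ℬ.ι) (zeroCommι j R).hom fun D g =>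
    congrArg (·.hom) (zeroCommι_comp j (ℬ.homMk g : R ⟶ j.obj D))
  rw [← cancel_mono (zeroCommι j _), zeroCommMap_zeroCommι, zeroCommMap_zeroCommι]
  apply ObjectProperty.hom_ext
  change (zeroCommι j R).hom ≫ (pullback.fst f f).hom =
    (zeroCommι j R).hom ≫ (pullback.snd f f).hom
  rw [← hl, Category.assoc, Category.assoc, ← zeroCommMap_zeroCommι, ← zeroCommMap_zeroCommι,
    hj.comp_ι.zeroCommMap_eq h (congrArg (·.hom) (pullback.condition (f := f) (g := f)))]

end Subcategory

end SemiAb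

/-! ### Comparison of the two universal central extensions. -/

theorem mainTheorem9 {𝒜 : Type u} [Category.{v} 𝒜] [HasZeroMorphisms 𝒜] [SemiAbelian 𝒜]
    [EnoughRegProjectives 𝒜]
    (ℬ : ObjectProperty 𝒜) [Birkhoff ℬ]
    (𝒞 : ObjectProperty ℬ.FullSubcategory) [Birkhoff 𝒞]
    (B : ℬ.FullSubcategory) (hB : IsPerfect 𝒞.ι B)
    {P : 𝒜} (p : P ⟶ B.obj) (hp : IsProjPresentation p)
    {Q : ℬ.FullSubcategory} (q : Q ⟶ B) (hq : IsProjPresentation q) :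
    IsUniversalCentralExt (𝒞.ι ⋙ ℬ.ι) (baerUMap (𝒞.ι ⋙ ℬ.ι) p) ∧
    IsUniversalCentralExt 𝒞.ι (baerUMap 𝒞.ι q) ∧
    (∃ (c : baerU (𝒞.ι ⋙ ℬ.ι) p ⟶ ℬ.ι.obj (baerU 𝒞.ι q))
      (k : zeroComm ℬ.ι (baerU (𝒞.ι ⋙ ℬ.ι) p) ⟶ hopfH2 (𝒞.ι ⋙ ℬ.ι) p)
      (π : hopfH2 (𝒞.ι ⋙ ℬ.ι) p ⟶ ℬ.ι.obj (hopfH2 𝒞.ι q)),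
      c ≫ ℬ.ι.map (baerUMap 𝒞.ι q) = baerUMap (𝒞.ι ⋙ ℬ.ι) p ∧
      k ≫ hopfH2ι (𝒞.ι ⋙ ℬ.ι) p = zeroCommι ℬ.ι (baerU (𝒞.ι ⋙ ℬ.ι) p) ∧
      π ≫ ℬ.ι.map (hopfH2ι 𝒞.ι q) = hopfH2ι (𝒞.ι ⋙ ℬ.ι) p ≫ c ∧
      IsShortExact k π) ∧
    ((∃ e : baerU (𝒞.ι ⋙ ℬ.ι) p ≅ ℬ.ι.obj (baerU 𝒞.ι q),
        e.hom ≫ ℬ.ι.map (baerUMap 𝒞.ι q) = baerUMap (𝒞.ι ⋙ ℬ.ι) p) ↔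
      IsZero (zeroComm ℬ.ι (baerU (𝒞.ι ⋙ ℬ.ι) p))) := by
  have := semiAbelian_fullSubcategory (ℬ := ℬ)
  have hℬ := isBirkhoffFunctor_ι ℬ
  have hj := isBirkhoffFunctor_ι 𝒞
  have hi : IsBirkhoffFunctor (𝒞.ι ⋙ ℬ.ι) := hj.comp_ι
  have hu : IsUniversalCentralExt (𝒞.ι ⋙ ℬ.ι) (baerUMap (𝒞.ι ⋙ ℬ.ι) p) :=
    hi.isUniversalCentralExt_baerUMap hp.regularEpi (fun D g => congrArg (·.hom)
      (hB.eq_zero 𝒞.ι (ℬ.homMk g : B ⟶ 𝒞.ι.obj D))) hp.projective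
  have hu' : IsUniversalCentralExt 𝒞.ι (baerUMap 𝒞.ι q) :=
    hj.isUniversalCentralExt_baerUMap hq.regularEpi (fun D g => hB.eq_zero 𝒞.ι g) hq.projective
  obtain ⟨c, hcu, hcr, hck⟩ : ∃ c : baerU (𝒞.ι ⋙ ℬ.ι) p ⟶ ℬ.ι.obj (baerU 𝒞.ι q),
      c ≫ ℬ.ι.map (baerUMap 𝒞.ι q) = baerUMap (𝒞.ι ⋙ ℬ.ι) p ∧ IsRegularEpi c ∧
      ∀ ⦃T : 𝒜⦄ (t : T ⟶ _), t ≫ c = 0 → ∃ l, l ≫ zeroCommι ℬ.ι _ = t := by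
    obtain ⟨c, hc, -⟩ := hu.2 _ _ (hj.isCentralExt_hom hu'.1)
    obtain ⟨v, hv⟩ := exists_unitMap_comp ℬ.ι (D := B) (baerUMap (𝒞.ι ⋙ ℬ.ι) p)
    obtain ⟨d, rfl⟩ := exists_unitMap_comp ℬ.ι (D := baerU 𝒞.ι q) c
    have hη := hℬ.isRegularEpi_unitMap (baerU (𝒞.ι ⋙ ℬ.ι) p)
    have hvc : IsCentralExt (𝒞.ι ⋙ ℬ.ι) (ℬ.ι.map v) :=
      hi.isCentralExt_of_comp hη (hv.symm ▸ hu.1)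
    -- The reflection of `U(B, JI)` is central over `B`, so initiality of `U(B, J)` gives a
    -- candidate inverse of `d`; each composite is the identity by uniqueness.
    obtain ⟨e, he, -⟩ := hu'.2 _ _ (hj.isCentralExt_of_hom (f := v) hvc)
    have hd : d ≫ baerUMap 𝒞.ι q = v := by
      apply ℬ.ι.map_injective
      rw [← cancel_epi (unitMap ℬ.ι _), hv, Functor.map_comp, ← hc, Category.assoc]
      rfl
    have hde : d ≫ e = 𝟙 _ := by
      apply ℬ.ι.map_injective
      rw [← cancel_epi (unitMap ℬ.ι _)]
      refine (hu.2 _ _ hvc).unique ?_ ?_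
      · rw [Category.assoc, ← Functor.map_comp, Category.assoc, he, hd, hv]
      · rw [Category.assoc, ← Functor.map_comp, Category.id_comp, hv]
    have hed : e ≫ d = 𝟙 _ :=
      (hu'.2 _ _ hu'.1).unique (by rw [Category.assoc, hd, he]) (Category.id_comp _)
    have : IsIso d := ⟨e, hde, hed⟩
    refine ⟨_, hc, isRegularEpi_comp hη inferInstance, fun T t ht => ?_⟩
    refine ⟨kernel.lift _ t ?_, kernel.lift_ι _ _ _⟩
    rw [← cancel_mono (ℬ.ι.map d), Category.assoc, ht, zero_comp]
  have hmono : Mono (ℬ.ι.map (hopfH2ι 𝒞.ι q)) := inferInstance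
  have hker : ∀ ⦃T : 𝒜⦄ (t : T ⟶ ℬ.ι.obj (baerU 𝒞.ι q)), t ≫ ℬ.ι.map (baerUMap 𝒞.ι q) = 0 →
      ∃ l, l ≫ ℬ.ι.map (hopfH2ι 𝒞.ι q) = t := fun T t ht => by
    obtain ⟨t', rfl⟩ := exists_unitMap_comp ℬ.ι (D := baerU 𝒞.ι q) t
    have hη := hℬ.isRegularEpi_unitMap T
    obtain ⟨l, rfl⟩ := exists_comp_hopfH2ι q t' (by
      apply ℬ.ι.map_injective
      rw [← cancel_epi (unitMap ℬ.ι _), Functor.map_comp, ← Category.assoc, ht]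
      exact comp_zero.symm)
    exact ⟨unitMap ℬ.ι T ≫ ℬ.ι.map l, by rw [Category.assoc, ← Functor.map_comp]⟩
  -- Since `B` lies in `ℬ`, the commutator `[U, U]_ℬ` vanishes in `B`.
  obtain ⟨k, hk⟩ := exists_comp_hopfH2ι p (zeroCommι ℬ.ι (baerU (𝒞.ι ⋙ ℬ.ι) p))
    (zeroCommι_comp ℬ.ι (D := B) _)
  obtain ⟨π, hπ⟩ := hker (hopfH2ι (𝒞.ι ⋙ ℬ.ι) p ≫ c) (by
    rw [Category.assoc, hcu, hopfH2ι_baerUMap])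
  have hkm : Mono k := by
    have : Mono (k ≫ hopfH2ι (𝒞.ι ⋙ ℬ.ι) p) := by rw [hk]; infer_instance
    exact mono_of_mono k (hopfH2ι (𝒞.ι ⋙ ℬ.ι) p)
  have hkπ : k ≫ π = 0 := by
    rw [← cancel_mono (ℬ.ι.map (hopfH2ι 𝒞.ι q)), Category.assoc, hπ, ← Category.assoc, hk,
      zeroCommι_comp ℬ.ι c, zero_comp]
  have hlift : ∀ ⦃T : 𝒜⦄ (t : T ⟶ _), t ≫ π = 0 → ∃ l, l ≫ k = t := fun T t ht => by
    obtain ⟨l, hl⟩ := hck (t ≫ hopfH2ι (𝒞.ι ⋙ ℬ.ι) p) (by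
      rw [Category.assoc, ← hπ, ← Category.assoc, ht, zero_comp])
    exact ⟨l, by rw [← cancel_mono (hopfH2ι (𝒞.ι ⋙ ℬ.ι) p), Category.assoc, hk, hl]⟩
  have hπr : IsRegularEpi π := by
    -- Elements of `H₂(B, J)` lift along `c` after a cover; the lifts vanish in `B`, so they lie in
    -- `H₂(B, JI)`.
    obtain ⟨S, d, s, hd, hs⟩ := exists_cover c hcr (ℬ.ι.map (hopfH2ι 𝒞.ι q))
    obtain ⟨l, rfl⟩ := exists_comp_hopfH2ι p s (by
      rw [← hcu, ← Category.assoc, hs, Category.assoc, ← Functor.map_comp, hopfH2ι_baerUMap]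
      exact comp_zero)
    have hl : l ≫ π = d := by
      rw [← cancel_mono (ℬ.ι.map (hopfH2ι 𝒞.ι q)), Category.assoc, hπ, ← hs, Category.assoc]
    exact isRegularEpi_of_comp (hl ▸ hd)
  have hdesc : ∀ ⦃Z : 𝒜⦄ (z : _ ⟶ Z), k ≫ z = 0 → ∃ g, π ≫ g = z := fun Z z hz => by
    obtain ⟨l, hl⟩ := hlift (kernel.ι π) (kernel.condition π)
    exact exists_desc_of_kernel hπr z (by rw [← hl, Category.assoc, hz, comp_zero])
  refine ⟨hu, hu', ⟨c, k, π, hcu, hk, hπ, hkπ, ⟨?_⟩, ⟨?_⟩⟩, ?_, ?_⟩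
  · exact KernelFork.IsLimit.ofι _ _ (fun t ht => (hlift t ht).choose)
      (fun t ht => (hlift t ht).choose_spec)
      (fun t ht m hm => by rw [← cancel_mono k, hm, (hlift t ht).choose_spec])
  · exact CokernelCofork.IsColimit.ofπ _ _ (fun z hz => (hdesc z hz).choose)
      (fun z hz => (hdesc z hz).choose_spec)
      (fun z hz m hm => by rw [← cancel_epi π, hm, (hdesc z hz).choose_spec])
  · rintro ⟨e, -⟩
    have h := zeroCommι_comp ℬ.ι (D := baerU 𝒞.ι q) e.hom
    refine IsZero.of_mono_eq_zero (zeroCommι ℬ.ι _) ?_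
    rw [← cancel_mono e.hom, h, zero_comp]
  · intro hz
    have hcm : Mono c := mono_of_forall_eq_zero c fun T t ht => by
      obtain ⟨l, rfl⟩ := hck t ht
      rw [hz.eq_of_tgt l 0, zero_comp]
    have := isIso_of_isRegularEpi_of_mono hcr hcm
    exact ⟨asIso c, hcu⟩
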